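/- Setting. Let $g:\mathbb R\to\mathbb C$ be a measurable signal of period $1$ with $|g(t)|<1$ for all $t$, with Fourier coefficients $a_k=\int_0^1 g(t)e^{-2\pi\mathrm{i}kt}\,dt$. Let $k_1\in\mathbb N=\{0,1,2,\dots\}$, $\gamma>0$ and $d\ge 0$, and say that $g$ is quasi-bandlimited with parameters $(k_1,\gamma)$ and constant $d$ if $|a_k|\le d\,e^{-\gamma|k|}$ for all $k\in\mathbb Z$ with $|k|\ge k_1$. Let $t_1\le\dots\le t_N$ be the order statistics of $N$ independent $\mathrm{Uniform}(0,1)$ random variables. For $\bar\delta,N_{\bar\delta}\in\mathbb N$, a bijection $h:\{1,\dots,N\}\to\{1,\dots,N\}$ is called good$(\bar\delta,N_{\bar\delta})$ if $|i-h(i)|>\bar\delta$ for at most $N_{\bar\delta}$ indices $i$. Let $\varepsilon(t)$, $t\in(0,1)$, be a complex-valued noise process, independent of the sampling locations, such that $\mathbb E\,\varepsilon(t)=0$ and $\mathbb E|\varepsilon(t)|^2=\sigma^2$ for every $t$, and such that its values at any finitely many distinct points are independent. (Expectations are taken over the noise with the locations held fixed, and then over the locations.) Put $t'_i=t_{h(i)}$,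 let $k_0=\lceil \log N/\gamma\rceil$, and define $$\bar a_k=\frac1N\sum_{i=1}^N\bigl(g(t'_i)+\varepsilon(t'_i)\bigr)e^{-2\pi\mathrm{i}ki/N},\qquad \bar g^{k_0}(t)=\sum_{k=-k_0}^{k_0}\bar a_k e^{2\pi\mathrm{i}kt},$$ where $\mathrm{i}$ is the imaginary unit and $i$ the summation index. Write $\|\cdot\|_2$ for the norm of $L^2(0,1)$. Theorem. For every $d\ge0$ there is a constant $C_1$, depending only on $d$, such that for every $k_1\in\mathbb N$, every $\gamma>0$, every $g$ as above that is quasi-bandlimited with parameters $(k_1,\gamma)$ and constant $d$, every $\bar\delta,N_{\bar\delta}\in\mathbb N$, every $N>e^{\gamma k_1}$, every bijection $h$ that is good$(\bar\delta,N_{\bar\delta})$, every $\sigma$ and every noise process $\varepsilon$ as above, $$\mathbb E\,\|g-\bar g^{k_0}\|_2^2\le C_1\left(\frac{N_{\bar\delta}k_0+k_0^3}{N}+\frac{k_0^3\bar\delta^2}{N^2}+\frac{k_0\sigma^2}{N}\right).$$ Moreover, for every $d\ge 0$ and $\Gamma>0$ there is a constant $C_2$, depending only on $d$ and $\Gamma$,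 such that in the same setting, if $k_1\ge1$ or $\gamma\le\Gamma$, then $$\mathbb E\,\|g-\bar g^{k_0}\|_2^2\le C_2\left(\frac{N_{\bar\delta}\gamma^2\log N+\log^3N}{\gamma^3N}+\frac{\bar\delta^2\log^3N}{\gamma^3N^2}+\frac{\sigma^2\log N}{\gamma N}\right).$$ -/

import Mathlib

open MeasureTheory ProbabilityTheory
open scoped ENNReal

noncomputable section

/-- Measurable signals of period `1` on the real line that are bounded by `1` in modulus
(strictly, at every point). -/
structure IsUnitSignal (g : ℝ → ℂ) : Prop where
  measurable : Measurable g
  periodic : Function.Periodic g 1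
  norm_lt_one : ∀ t, ‖g t‖ < 1

/-- The `k`-th Fourier series coefficient of a signal of period `1`. -/
def sigCoeff (g : ℝ → ℂ) (k : ℤ) : ℂ :=
  fourierCoeffOn (zero_lt_one : (0 : ℝ) < 1) g k

/-- `g` is quasi-bandlimited with parameters `k₁` and `γ`, and with constant `d`. -/
def IsQuasiBandlimited (d : ℝ) (k₁ : ℕ) (γ : ℝ) (g : ℝ → ℂ) : Prop :=
  ∀ k : ℤ, (k₁ : ℤ) ≤ |k| → ‖sigCoeff g k‖ ≤ d * Real.exp (-γ * |(k : ℝ)|)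

/-- The bijection `h` displaces at most `Nδ` indices by more than `δ`. -/
def IsGood {N : ℕ} (δ Nδ : ℕ) (h : Equiv.Perm (Fin N)) : Prop :=
  (Finset.univ.filter fun i : Fin N => (δ : ℤ) < |((i : ℕ) : ℤ) - ((h i : ℕ) : ℤ)|).card ≤ Nδ

/-- Independent random variables, each uniformly distributed on the interval `(0, 1)`. -/
structure IsUniformSample {Ω : Type*} [MeasurableSpace Ω] {N : ℕ}
    (U : Fin N → Ω → ℝ) (P : Measure Ω) : Prop where
  measurable : ∀ i, Measurable (U i)
  indep : iIndepFun U P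
  uniform : ∀ i, pdf.IsUniform (U i) (Set.Ioo 0 1) P volume

/-- The entries of `u` in nondecreasing order: entry `i` is the `(i + 1)`-st order statistic. -/
def sorted {N : ℕ} (u : Fin N → ℝ) : Fin N → ℝ :=
  u ∘ Tuple.sort u

/-- A noise process on the sampling domain `(0, 1)`: centred, of variance `σ ^ 2` at each point,
with independent values at any finitely many distinct points. -/
structure IsNoise {Ω : Type*} [MeasurableSpace Ω] (ε : ℝ → Ω → ℂ) (σ : ℝ)
    (Q : Measure Ω) : Prop where
  memLp : ∀ t ∈ Set.Ioo (0 : ℝ) 1, MemLp (ε t) 2 Q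
  mean : ∀ t ∈ Set.Ioo (0 : ℝ) 1, ∫ ω, ε t ω ∂Q = 0
  variance : ∀ t ∈ Set.Ioo (0 : ℝ) 1, ∫ ω, ‖ε t ω‖ ^ 2 ∂Q = σ ^ 2
  indep : ∀ (n : ℕ) (t : Fin n → ℝ), (∀ i, t i ∈ Set.Ioo (0 : ℝ) 1) → Function.Injective t →
    iIndepFun (fun i => ε (t i)) Q

/-- The estimated Fourier coefficient from the samples `y`: the `i`-th sample (for `i` from `1` to
`N`) is placed at the location `i / N`. Indices in `Fin N` start at `0`, whence the `+ 1`. -/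
def estCoeff {N : ℕ} (y : Fin N → ℂ) (k : ℤ) : ℂ :=
  (1 / (N : ℂ)) * ∑ i : Fin N,
    y i * Complex.exp (-(2 * Real.pi * Complex.I * k * (((i : ℕ) : ℂ) + 1) / N))

/-- The reconstructed signal of bandwidth `k₀`. -/
def reconstruction {N : ℕ} (y : Fin N → ℂ) (k₀ : ℕ) (s : ℝ) : ℂ :=
  ∑ k ∈ Finset.Icc (-(k₀ : ℤ)) k₀,
    estCoeff y k * Complex.exp (2 * Real.pi * Complex.I * k * s)

/-- The bandwidth `⌈log N / γ⌉` of the reconstruction. -/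
def bandwidth (N : ℕ) (γ : ℝ) : ℕ := ⌈Real.log N / γ⌉₊

/-- The noisy samples `g (t' i) + ε (t' i)`, where `t' i = t (h i)` and `t` lists the sampling
locations `u` in increasing order. -/
def samples {Ω' : Type*} {N : ℕ} (g : ℝ → ℂ) (h : Equiv.Perm (Fin N)) (ε : ℝ → Ω' → ℂ)
    (u : Fin N → ℝ) (ω' : Ω') : Fin N → ℂ :=
  fun i => g (sorted u (h i)) + ε (sorted u (h i)) ω'

/-- The squared `L²` distance of two signals over one period. -/
def sqDist (f g : ℝ → ℂ) : ℝ≥0∞ :=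
  ∫⁻ s in Set.Ioc (0 : ℝ) 1, ‖f s - g s‖ₑ ^ 2

/-- The expected squared `L²` error of the reconstruction of bandwidth `k₀`. The noise is
independent of the sampling locations: the expectation is over the noise at fixed locations first,
and then over the locations. -/
def expectedError {Ω Ω' : Type*} [MeasurableSpace Ω] [MeasurableSpace Ω'] {N : ℕ}
    (g : ℝ → ℂ) (h : Equiv.Perm (Fin N)) (U : Fin N → Ω → ℝ) (P : Measure Ω)
    (ε : ℝ → Ω' → ℂ) (Q : Measure Ω') (k₀ : ℕ) : ℝ≥0∞ :=
  ∫⁻ ω, ∫⁻ ω', sqDist g (reconstruction (samples g h ε (fun i => U i ω) ω') k₀) ∂Q ∂P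

end

/-! By Parseval, the error is the sum of the squared coefficient errors over `|k| ≤ k₀` plus the
energy of `g` beyond `k₀` (`sqDist_reconstruction_le`). The bandwidth makes `e^{-γk₀} ≤ 1/N`, so
that energy is `O(k₀/N)`.

Without noise, a coefficient error is `-(A + B + C)/N` (`norm_sq_sigCoeff_sub_estCoeff_le`). `A` is
the Monte Carlo error, a sum of `N` independent bounded centred terms, so its mean square is `O(N)`.
`B` comes from moving the sorted samples to the grid, and `C` from the permutation. As `e^{-2πiks}`
is Lipschitz in `s` with constant `2π|k|`, `B` is controlled by the gaps between the order
statistics and the grid, and `C` by `δ` plus a trivial bound at the at most `Nδ` badly displaced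
indices.

The laws of the order statistics are never needed: `N` times such a gap is the deviation of the
empirical distribution function at a sample point, and summing the squares over all sample points
forgets the order (`sum_sq_sorted_sub`). Given `U j`, that deviation is a sum of independent centred
indicators up to one term, so its mean square is `O(N)`. The noise adds `σ²/N` per coefficient by
orthogonality. Summing over the `2k₀ + 1` frequencies gives the first bound; the second replaces
`k₀` by a multiple of `log N / γ`. -/

/-! ### Fourier modes and coefficients -/

/-- The exponential `s ↦ e^{-2πiks}`. -/
noncomputable def expMode (k : ℤ) (s : ℝ) : ℂ :=
  Complex.exp (-(2 * Real.pi * Complex.I * k * s))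

lemma expMode_eq_exp_ofReal_mul_I (k : ℤ) (s : ℝ) :
    expMode k s = Complex.exp (((-(2 * Real.pi * k * s) : ℝ) : ℂ) * Complex.I) := by
  unfold expMode
  congr 1
  push_cast
  ring

lemma norm_expMode (k : ℤ) (s : ℝ) : ‖expMode k s‖ = 1 := by
  rw [expMode_eq_exp_ofReal_mul_I, Complex.norm_exp_ofReal_mul_I]

lemma continuous_expMode (k : ℤ) : Continuous (expMode k) := by
  unfold expMode
  fun_prop

lemma expMode_mul_expMode_neg (k m : ℤ) (s : ℝ) :
    expMode k s * expMode (-m) s = expMode (k - m) s := by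
  unfold expMode
  rw [← Complex.exp_add]
  congr 1
  push_cast
  ring

/-- Factoring out a unimodular number leaves `|e^{iθ} - 1| ≤ |θ|`. The factor `|k|`, squared and
summed over `|k| ≤ k₀`, is the source of `k₀³` in the bounds. -/
lemma norm_expMode_sub_le (k : ℤ) (s t : ℝ) :
    ‖expMode k s - expMode k t‖ ≤ 2 * Real.pi * |(k : ℝ)| * |s - t| := by
  have h : expMode k s - expMode k t =
      expMode k t * (Complex.exp (Complex.I * ((-(2 * Real.pi * k * (s - t)) : ℝ) : ℂ)) - 1) := by
    unfold expMode
    rw [mul_sub, ← Complex.exp_add, mul_one]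
    congr 2
    push_cast
    ring
  rw [h, norm_mul, norm_expMode, one_mul]
  refine (Real.norm_exp_I_mul_ofReal_sub_one_le).trans (le_of_eq ?_)
  rw [Real.norm_eq_abs, abs_neg, abs_mul, abs_mul, abs_mul, abs_of_pos Real.pi_pos]
  norm_num

lemma integral_expMode (k : ℤ) :
    ∫ s in (0 : ℝ)..1, expMode k s = if k = 0 then 1 else 0 := by
  split_ifs with hk
  · simp [expMode, hk]
  · have hc : -(2 * Real.pi * Complex.I * k) ≠ 0 := by
      simp [Real.pi_ne_zero, hk]
    have h : ∀ s : ℝ, expMode k s = Complex.exp (-(2 * Real.pi * Complex.I * k) * s) := by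
      intro s
      unfold expMode
      congr 1
      ring
    simp_rw [h]
    rw [integral_exp_mul_complex hc]
    have h1 : Complex.exp (-(2 * Real.pi * Complex.I * k) * (1 : ℝ)) = 1 := by
      rw [Complex.exp_eq_one_iff]
      exact ⟨-k, by push_cast; ring⟩
    rw [h1]
    simp

lemma sigCoeff_eq_integral (g : ℝ → ℂ) (k : ℤ) :
    sigCoeff g k = ∫ s in (0 : ℝ)..1, expMode k s * g s := by
  unfold sigCoeff
  rw [fourierCoeffOn_eq_integral]
  simp only [sub_zero, ne_eq, one_ne_zero, not_false_eq_true, div_self, one_smul, smul_eq_mul]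
  refine intervalIntegral.integral_congr fun s _ => ?_
  rw [fourier_coe_apply]
  unfold expMode
  congr 2
  push_cast
  ring

lemma estCoeff_eq_sum {N : ℕ} (y : Fin N → ℂ) (k : ℤ) :
    estCoeff y k = (1 / (N : ℂ)) * ∑ i : Fin N, y i * expMode k (((i : ℕ) + 1 : ℝ) / N) := by
  unfold estCoeff expMode
  congr 1
  refine Finset.sum_congr rfl fun i _ => ?_
  congr 2
  push_cast
  ring

lemma reconstruction_eq_sum {N : ℕ} (y : Fin N → ℂ) (k₀ : ℕ) (s : ℝ) :
    reconstruction y k₀ s =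
      ∑ k ∈ Finset.Icc (-(k₀ : ℤ)) k₀, estCoeff y k * expMode (-k) s := by
  unfold reconstruction expMode
  refine Finset.sum_congr rfl fun k _ => ?_
  congr 2
  push_cast
  ring

lemma continuous_reconstruction {N : ℕ} (y : Fin N → ℂ) (k₀ : ℕ) :
    Continuous (reconstruction y k₀) := by
  have h : reconstruction y k₀ = fun s =>
      ∑ k ∈ Finset.Icc (-(k₀ : ℤ)) k₀, estCoeff y k * expMode (-k) s :=
    funext (reconstruction_eq_sum y k₀)
  rw [h]
  exact continuous_finsetSum _ fun k _ => continuous_const.mul (continuous_expMode _)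

lemma norm_reconstruction_le {N : ℕ} (y : Fin N → ℂ) (k₀ : ℕ) (s : ℝ) :
    ‖reconstruction y k₀ s‖ ≤ ∑ k ∈ Finset.Icc (-(k₀ : ℤ)) k₀, ‖estCoeff y k‖ := by
  rw [reconstruction_eq_sum]
  refine (norm_sum_le _ _).trans (le_of_eq ?_)
  simp [norm_expMode]

lemma sigCoeff_reconstruction {N : ℕ} (y : Fin N → ℂ) (k₀ : ℕ) (k : ℤ) :
    sigCoeff (reconstruction y k₀) k =
      if k ∈ Finset.Icc (-(k₀ : ℤ)) k₀ then estCoeff y k else 0 := by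
  rw [sigCoeff_eq_integral]
  have h : ∀ s, expMode k s * reconstruction y k₀ s =
      ∑ m ∈ Finset.Icc (-(k₀ : ℤ)) k₀, estCoeff y m * expMode (k - m) s := by
    intro s
    rw [reconstruction_eq_sum, Finset.mul_sum]
    refine Finset.sum_congr rfl fun m _ => ?_
    rw [← expMode_mul_expMode_neg]
    ring
  simp_rw [h]
  rw [intervalIntegral.integral_finsetSum (f := fun m s => estCoeff y m * expMode (k - m) s)
    fun m _ => (continuous_const.mul (continuous_expMode _)).intervalIntegrable _ _]
  simp_rw [intervalIntegral.integral_const_mul, integral_expMode, sub_eq_zero]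
  simp

lemma IsUnitSignal.integrable_expMode_mul {g : ℝ → ℂ} (hg : IsUnitSignal g) (k : ℤ)
    (μ : Measure ℝ) [IsFiniteMeasure μ] : Integrable (fun s => expMode k s * g s) μ := by
  refine Integrable.of_bound
    ((continuous_expMode k).measurable.mul hg.measurable).aestronglyMeasurable 1 ?_
  refine Filter.Eventually.of_forall fun s => ?_
  rw [norm_mul, norm_expMode, one_mul]
  exact (hg.norm_lt_one s).le

lemma IsUnitSignal.norm_sigCoeff_le {g : ℝ → ℂ} (hg : IsUnitSignal g) (k : ℤ) :
    ‖sigCoeff g k‖ ≤ 1 := by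
  rw [sigCoeff_eq_integral]
  have := intervalIntegral.norm_integral_le_of_norm_le_const (a := (0 : ℝ)) (b := 1)
    (f := fun s => expMode k s * g s) (C := 1) fun s _ => by
      rw [norm_mul, norm_expMode, one_mul]
      exact (hg.norm_lt_one s).le
  simpa using this

/-! ### Parseval and the truncation tail -/

/-- Parseval's identity for the reconstruction error. -/
lemma IsUnitSignal.exists_hasSum_sqDist {g : ℝ → ℂ} (hg : IsUnitSignal g) {N : ℕ}
    (y : Fin N → ℂ) (k₀ : ℕ) :
    ∃ E : ℝ, sqDist g (reconstruction y k₀) = ENNReal.ofReal E ∧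
      HasSum (fun k : ℤ => ‖sigCoeff g k -
        if k ∈ Finset.Icc (-(k₀ : ℤ)) k₀ then estCoeff y k else 0‖ ^ 2) E := by
  have hL2 : MemLp (fun s => g s - reconstruction y k₀ s) 2
      (volume.restrict (Set.Ioc (0 : ℝ) 1)) := by
    refine MemLp.of_bound (hg.measurable.sub
      (continuous_reconstruction y k₀).measurable).aestronglyMeasurable
      (1 + ∑ k ∈ Finset.Icc (-(k₀ : ℤ)) k₀, ‖estCoeff y k‖) ?_
    refine Filter.Eventually.of_forall fun s => (norm_sub_le _ _).trans ?_
    exact add_le_add (hg.norm_lt_one s).le (norm_reconstruction_le y k₀ s)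
  refine ⟨∫ s in Set.Ioc (0 : ℝ) 1, ‖g s - reconstruction y k₀ s‖ ^ 2, ?_, ?_⟩
  · rw [ofReal_integral_eq_lintegral_ofReal hL2.integrable_norm_pow'
      (Filter.Eventually.of_forall fun s => by positivity)]
    unfold sqDist
    refine lintegral_congr fun s => ?_
    rw [ENNReal.ofReal_pow (norm_nonneg _), ofReal_norm]
  · have h := hasSum_sq_fourierCoeffOn zero_lt_one hL2
    rw [intervalIntegral.integral_of_le zero_le_one] at h
    simp only [sub_zero, inv_one, one_smul] at h
    convert h using 4 with k
    rw [← sigCoeff_reconstruction]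
    change _ = sigCoeff _ k
    simp_rw [sigCoeff_eq_integral, mul_sub]
    rw [intervalIntegral.integral_sub]
    · rw [intervalIntegrable_iff_integrableOn_Ioc_of_le zero_le_one]
      exact hg.integrable_expMode_mul k _
    · exact ((continuous_expMode k).mul (continuous_reconstruction y k₀)).intervalIntegrable _ _

lemma hasSum_pow_natAbs {q : ℝ} (hq : 0 ≤ q) (hq1 : q < 1) :
    HasSum (fun k : ℤ => q ^ k.natAbs) ((1 - q)⁻¹ + q * (1 - q)⁻¹) := by
  have h := hasSum_geometric_of_lt_one hq hq1
  refine HasSum.of_nat_of_neg_add_one (by simpa using h) ?_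
  refine (h.mul_left q).congr_fun fun n => ?_
  rw [← pow_succ']
  congr 1

/-- Up to the contribution of the high frequencies, the reconstruction error is the error of the
estimated Fourier coefficients. -/
lemma sqDist_reconstruction_le {d γ : ℝ} {k₁ k₀ N : ℕ} {g : ℝ → ℂ} (hγ : 0 < γ)
    (hg : IsUnitSignal g) (hb : IsQuasiBandlimited d k₁ γ g) (hk : k₁ ≤ k₀) (y : Fin N → ℂ) :
    sqDist g (reconstruction y k₀) ≤ ENNReal.ofReal
      (∑ k ∈ Finset.Icc (-(k₀ : ℤ)) k₀, ‖sigCoeff g k - estCoeff y k‖ ^ 2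
        + 2 * d ^ 2 * Real.exp (-γ * k₀) * (1 + 1 / γ)) := by
  obtain ⟨E, hE, hsum⟩ := hg.exists_hasSum_sqDist y k₀
  rw [hE]
  apply ENNReal.ofReal_le_ofReal
  set q := Real.exp (-γ) with hq
  have hq0 : 0 < q := Real.exp_pos _
  have hq1 : q < 1 := by rw [hq, Real.exp_lt_one_iff]; linarith
  -- This is `e^γ ≥ 1 + γ` rearranged; the `1/γ` is later absorbed into `k₀`.
  have hinv : (1 - q)⁻¹ ≤ 1 + 1 / γ := by
    have h1 : 1 + γ ≤ Real.exp γ := by linarith [Real.add_one_le_exp γ]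
    have h2 : q * Real.exp γ = 1 := by rw [hq, ← Real.exp_add]; simp
    have h3 : q * (1 + γ) ≤ 1 := by nlinarith
    rw [inv_le_iff_one_le_mul₀ (by linarith)]
    have : (1 + 1 / γ) * (1 - q) = (1 + γ - q * (1 + γ)) / γ := by field_simp; ring
    rw [this, le_div_iff₀ hγ]
    linarith
  set c : ℤ → ℝ := fun k => ‖sigCoeff g k - estCoeff y k‖ ^ 2
  have hfin : HasSum (fun k : ℤ => if k ∈ Finset.Icc (-(k₀ : ℤ)) k₀ then c k else 0)
      (∑ k ∈ Finset.Icc (-(k₀ : ℤ)) k₀, c k) := by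
    rw [← Finset.sum_congr rfl fun k hk => if_pos hk]
    exact hasSum_sum_of_ne_finset_zero fun k hk => if_neg hk
  have htail := (hasSum_pow_natAbs hq0.le hq1).mul_left (d ^ 2 * Real.exp (-γ * k₀))
  refine (hasSum_le (fun k => ?_) hsum (hfin.add htail)).trans ?_
  · by_cases hmem : k ∈ Finset.Icc (-(k₀ : ℤ)) k₀
    · simp only [if_pos hmem, c]
      have : 0 ≤ d ^ 2 * Real.exp (-γ * k₀) * q ^ k.natAbs := by positivity
      linarith
    · simp only [if_neg hmem, sub_zero, zero_add]
      have hka : (k₀ : ℤ) < |k| := by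
        rwa [Finset.mem_Icc, ← abs_le, not_le] at hmem
      have hkr : (k₀ : ℝ) ≤ |(k : ℝ)| := by exact_mod_cast hka.le
      have h1 := hb k (by have : (k₁ : ℤ) ≤ k₀ := by exact_mod_cast hk
                          linarith)
      have h2 : q ^ k.natAbs = Real.exp (-γ * |(k : ℝ)|) := by
        rw [hq, ← Real.exp_nat_mul, mul_comm, Nat.cast_natAbs, Int.cast_abs]
      rw [h2]
      -- One of the two decay factors yields the small `e^{-γk₀}`, the other keeps the series over
      -- all of `ℤ` summable.
      calc ‖sigCoeff g k‖ ^ 2 ≤ (d * Real.exp (-γ * |(k : ℝ)|)) ^ 2 :=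
            pow_le_pow_left₀ (norm_nonneg _) h1 2
        _ = d ^ 2 * Real.exp (-γ * |(k : ℝ)|) * Real.exp (-γ * |(k : ℝ)|) := by ring
        _ ≤ d ^ 2 * Real.exp (-γ * k₀) * Real.exp (-γ * |(k : ℝ)|) := by
            have : Real.exp (-γ * |(k : ℝ)|) ≤ Real.exp (-γ * k₀) :=
              Real.exp_le_exp.2 (by nlinarith)
            gcongr
  · have : (1 - q)⁻¹ + q * (1 - q)⁻¹ ≤ 2 * (1 + 1 / γ) := by
      have : 0 < (1 - q)⁻¹ := inv_pos.2 (by linarith)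
      nlinarith
    have h0 : 0 ≤ d ^ 2 * Real.exp (-γ * k₀) := by positivity
    nlinarith

/-! ### Orthogonal random vectors -/

section Orthogonality

variable {Ω E ι : Type*} [MeasurableSpace Ω] {μ : Measure Ω}
  [NormedAddCommGroup E] [InnerProductSpace ℝ E]

lemma integrable_inner_of_memLp_two [IsFiniteMeasure μ] {X Y : Ω → E} (hX : MemLp X 2 μ) (hY : MemLp Y 2 μ) :
    Integrable (fun ω => inner ℝ (X ω) (Y ω)) μ := by
  refine (hX.integrable_norm_pow'.add hY.integrable_norm_pow').mono'
    (hX.aestronglyMeasurable.inner hY.aestronglyMeasurable) ?_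
  refine Filter.Eventually.of_forall fun ω => (norm_inner_le_norm _ _).trans ?_
  rw [Pi.add_apply]
  nlinarith [sq_nonneg (‖X ω‖ - ‖Y ω‖), sq_nonneg ‖X ω‖, sq_nonneg ‖Y ω‖]

/-- The expected squared norm of a sum of pairwise orthogonal random vectors. -/
lemma integral_norm_sq_sum_of_orthogonal [IsFiniteMeasure μ] {X : ι → Ω → E} {s : Finset ι}
    (hX : ∀ i ∈ s, MemLp (X i) 2 μ)
    (horth : ∀ i ∈ s, ∀ j ∈ s, i ≠ j → ∫ ω, inner ℝ (X i ω) (X j ω) ∂μ = 0) :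
    ∫ ω, ‖∑ i ∈ s, X i ω‖ ^ 2 ∂μ = ∑ i ∈ s, ∫ ω, ‖X i ω‖ ^ 2 ∂μ := by
  have h : ∀ ω, ‖∑ i ∈ s, X i ω‖ ^ 2 = ∑ i ∈ s, ∑ j ∈ s, inner ℝ (X i ω) (X j ω) := by
    intro ω
    rw [← real_inner_self_eq_norm_sq, sum_inner]
    simp_rw [inner_sum]
  have hint : ∀ i ∈ s, ∀ j ∈ s, Integrable (fun ω => inner ℝ (X i ω) (X j ω)) μ :=
    fun i hi j hj => integrable_inner_of_memLp_two (hX i hi) (hX j hj)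
  simp_rw [h]
  rw [integral_finsetSum _ fun i hi => integrable_finsetSum _ fun j hj => hint i hi j hj]
  refine Finset.sum_congr rfl fun i hi => ?_
  rw [integral_finsetSum _ fun j hj => hint i hi j hj,
    Finset.sum_eq_single_of_mem i hi fun j hj hij => horth i hi j hj hij.symm]
  simp_rw [real_inner_self_eq_norm_sq]

lemma ProbabilityTheory.IndepFun.integral_inner_eq_zero [CompleteSpace E] [MeasurableSpace E]
    [BorelSpace E] {X Y : Ω → E} (h : IndepFun X Y μ) (hX : Integrable X μ)
    (hY : Integrable Y μ) (h0 : ∫ ω, X ω ∂μ = 0) :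
    ∫ ω, inner ℝ (X ω) (Y ω) ∂μ = 0 := by
  have h1 := h.integral_bilin hX hY (innerSL ℝ)
  rw [h0, map_zero] at h1
  exact h1

end Orthogonality

/-! ### Mean squares over the uniform sample -/

section Sample

variable {Ω : Type*} [MeasurableSpace Ω] {P : Measure Ω} {N : ℕ} {U : Fin N → Ω → ℝ}

lemma cond_Ioo_zero_one :
    ProbabilityTheory.cond (volume : Measure ℝ) (Set.Ioo 0 1) = volume.restrict (Set.Ioo 0 1) := by
  simp [ProbabilityTheory.cond]

lemma IsUniformSample.map_eq (hU : IsUniformSample U P) (i : Fin N) :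
    P.map (U i) = volume.restrict (Set.Ioo 0 1) :=
  (hU.uniform i).trans cond_Ioo_zero_one

lemma IsUniformSample.integral_comp (hU : IsUniformSample U P) (i : Fin N) {f : ℝ → ℂ}
    (hf : Measurable f) : ∫ ω, f (U i ω) ∂P = ∫ s in (0 : ℝ)..1, f s := by
  rw [← integral_map (hU.measurable i).aemeasurable hf.aestronglyMeasurable, hU.map_eq,
    intervalIntegral.integral_of_le zero_le_one, integral_Ioc_eq_integral_Ioo]

lemma IsUniformSample.ae_mem_Ioo (hU : IsUniformSample U P) :
    ∀ᵐ ω ∂P, ∀ i, U i ω ∈ Set.Ioo (0 : ℝ) 1 := by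
  rw [ae_all_iff]
  intro i
  refine ae_of_ae_map (hU.measurable i).aemeasurable (p := fun x => x ∈ Set.Ioo (0 : ℝ) 1) ?_
  rw [hU.map_eq]
  exact ae_restrict_mem measurableSet_Ioo

variable [IsProbabilityMeasure P]

/-- The joint law of two sample points is a product of atomless laws, so the diagonal is null.
Distinctness makes ranks exact and lets the independence of the noise values apply. -/
lemma IsUniformSample.ae_injective (hU : IsUniformSample U P) :
    ∀ᵐ ω ∂P, Function.Injective fun i => U i ω := by
  have h : ∀ i j, i ≠ j → ∀ᵐ ω ∂P, U i ω ≠ U j ω := by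
    intro i j hij
    have hm := (indepFun_iff_map_prod_eq_prod_map_map (hU.measurable i).aemeasurable
      (hU.measurable j).aemeasurable).1 (hU.indep.indepFun hij)
    refine ae_of_ae_map ((hU.measurable i).prodMk (hU.measurable j)).aemeasurable
      (p := fun x : ℝ × ℝ => x.1 ≠ x.2) ?_
    rw [hm, hU.map_eq, hU.map_eq]
    have hD : MeasurableSet {x : ℝ × ℝ | x.1 ≠ x.2} :=
      (measurableSet_eq_fun measurable_fst measurable_snd).compl
    rw [Measure.ae_prod_iff_ae_ae hD]
    refine Filter.Eventually.of_forall fun x => ?_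
    exact (Measure.ae_ne _ x).mono fun y hy => hy.symm
  have h' : ∀ᵐ ω ∂P, ∀ i j, i ≠ j → U i ω ≠ U j ω := by
    rw [ae_all_iff]
    intro i
    rw [ae_all_iff]
    intro j
    by_cases hij : i = j
    · exact Filter.Eventually.of_forall fun ω hne => (hne hij).elim
    · exact (h i j hij).mono fun ω hω _ => hω
  filter_upwards [h'] with ω hω i j hij
  by_contra hne
  exact hω i j hne hij

lemma IsUnitSignal.measurable_expMode_mul_sub {g : ℝ → ℂ} (hg : IsUnitSignal g) (k : ℤ) :
    Measurable fun s => expMode k s * g s - sigCoeff g k :=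
  ((continuous_expMode k).measurable.mul hg.measurable).sub measurable_const

lemma IsUnitSignal.norm_expMode_mul_sub_le {g : ℝ → ℂ} (hg : IsUnitSignal g) (k : ℤ) (s : ℝ) :
    ‖expMode k s * g s - sigCoeff g k‖ ≤ 2 := by
  refine (norm_sub_le _ _).trans ?_
  rw [norm_mul, norm_expMode, one_mul]
  linarith [hg.norm_lt_one s, hg.norm_sigCoeff_le k]

lemma IsUniformSample.memLp_expMode_mul_sub (hU : IsUniformSample U P) {g : ℝ → ℂ}
    (hg : IsUnitSignal g) (k : ℤ) (i : Fin N) :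
    MemLp (fun ω => expMode k (U i ω) * g (U i ω) - sigCoeff g k) 2 P :=
  MemLp.of_bound ((hg.measurable_expMode_mul_sub k).comp (hU.measurable i)).aestronglyMeasurable 2
    (Filter.Eventually.of_forall fun _ => hg.norm_expMode_mul_sub_le k _)

/-- The mean square error of the empirical Fourier coefficients. -/
lemma IsUniformSample.integral_norm_sq_sum_le (hU : IsUniformSample U P) {g : ℝ → ℂ}
    (hg : IsUnitSignal g) (k : ℤ) :
    ∫ ω, ‖∑ i, (expMode k (U i ω) * g (U i ω) - sigCoeff g k)‖ ^ 2 ∂P ≤ 4 * N := by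
  have hm := hg.measurable_expMode_mul_sub k
  have hb := hg.norm_expMode_mul_sub_le k
  have hL := hU.memLp_expMode_mul_sub hg k
  have h0 : ∀ i, ∫ ω, (expMode k (U i ω) * g (U i ω) - sigCoeff g k) ∂P = 0 := by
    intro i
    rw [hU.integral_comp i (f := fun s => expMode k s * g s - sigCoeff g k) hm,
      intervalIntegral.integral_sub, ← sigCoeff_eq_integral]
    · simp
    · rw [intervalIntegrable_iff_integrableOn_Ioc_of_le zero_le_one]
      exact hg.integrable_expMode_mul k _
    · simp
  rw [integral_norm_sq_sum_of_orthogonal fun i _ => hL i]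
  · refine (Finset.sum_le_card_nsmul _ _ 4 fun i _ => ?_).trans (le_of_eq ?_)
    · refine (integral_mono_of_nonneg (Filter.Eventually.of_forall fun ω => by positivity)
        (integrable_const (4 : ℝ)) (Filter.Eventually.of_forall fun ω => ?_)).trans (by simp)
      simp only
      nlinarith [hb (U i ω), norm_nonneg (expMode k (U i ω) * g (U i ω) - sigCoeff g k)]
    · simp [mul_comm]
  · intro i _ j _ hij
    exact ((hU.indep.indepFun hij).comp hm hm).integral_inner_eq_zero
      ((hL i).integrable one_le_two) ((hL j).integrable one_le_two) (h0 i)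

/-- The centred indicator of `x ≤ a`, for a uniformly distributed `x`. -/
noncomputable def centredIndicator (a x : ℝ) : ℝ := (if x ≤ a then 1 else 0) - a

lemma measurable_centredIndicator :
    Measurable fun p : ℝ × ℝ => centredIndicator p.1 p.2 :=
  (Measurable.ite (measurableSet_le measurable_snd measurable_fst) measurable_const
    measurable_const).sub measurable_fst

lemma abs_centredIndicator_le {a : ℝ} (ha : a ∈ Set.Ioo (0 : ℝ) 1) (x : ℝ) :
    |centredIndicator a x| ≤ 1 := by
  unfold centredIndicator
  rw [abs_le]
  split_ifs <;> constructor <;> linarith [ha.1, ha.2]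

lemma integral_centredIndicator {a : ℝ} (ha : a ∈ Set.Ioo (0 : ℝ) 1) :
    ∫ x in Set.Ioo (0 : ℝ) 1, centredIndicator a x = 0 := by
  have h : (fun x : ℝ => if x ≤ a then (1 : ℝ) else 0) =
      (Set.Iic a).indicator fun _ => (1 : ℝ) := by
    ext x
    simp [Set.indicator_apply]
  have hi : Integrable (fun x : ℝ => if x ≤ a then (1 : ℝ) else 0)
      (volume.restrict (Set.Ioo (0 : ℝ) 1)) := by
    rw [h]
    exact (integrable_const _).indicator measurableSet_Iic
  unfold centredIndicator
  rw [integral_sub hi (integrable_const _), h, integral_indicator measurableSet_Iic,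
    Measure.restrict_restrict measurableSet_Iic]
  have hs : Set.Iic a ∩ Set.Ioo (0 : ℝ) 1 = Set.Ioc 0 a := by
    ext x
    simp only [Set.mem_inter_iff, Set.mem_Iic, Set.mem_Ioo, Set.mem_Ioc]
    constructor
    · rintro ⟨h1, h2, _⟩
      exact ⟨h2, h1⟩
    · rintro ⟨h1, h2⟩
      exact ⟨h2, h1, h2.trans_lt ha.2⟩
  rw [hs]
  simp [ha.1.le]

lemma IsUniformSample.memLp_centredIndicator (hU : IsUniformSample U P) (j l : Fin N) :
    MemLp (fun ω => centredIndicator (U j ω) (U l ω)) 2 P := by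
  refine MemLp.of_bound (measurable_centredIndicator.comp
    ((hU.measurable j).prodMk (hU.measurable l))).aestronglyMeasurable 1 ?_
  filter_upwards [hU.ae_mem_Ioo] with ω hω
  exact abs_centredIndicator_le (hω j) _

/-- The two factors share `U j`, so they are not treated as independent. Instead `U m` is
independent of the pair `(U j, U l)`, and integrating it out first already gives zero. -/
lemma IsUniformSample.integral_centredIndicator_mul (hU : IsUniformSample U P) {j l m : Fin N}
    (hjm : j ≠ m) (hlm : l ≠ m) :
    ∫ ω, centredIndicator (U j ω) (U l ω) * centredIndicator (U j ω) (U m ω) ∂P = 0 := by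
  set φ : (ℝ × ℝ) × ℝ → ℝ := fun p =>
    centredIndicator p.1.1 p.1.2 * centredIndicator p.1.1 p.2 with hφ
  have hφm : Measurable φ :=
    (measurable_centredIndicator.comp measurable_fst).mul
      (measurable_centredIndicator.comp
        ((measurable_fst.comp measurable_fst).prodMk measurable_snd))
  have hjl : Measurable fun ω => (U j ω, U l ω) := (hU.measurable j).prodMk (hU.measurable l)
  have hV : Measurable fun ω => ((U j ω, U l ω), U m ω) := hjl.prodMk (hU.measurable m)
  have hmap := (indepFun_iff_map_prod_eq_prod_map_map hjl.aemeasurable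
    (hU.measurable m).aemeasurable).1 (hU.indep.indepFun_prodMk hU.measurable j l m hjm hlm)
  rw [hU.map_eq m] at hmap
  change ∫ ω, φ ((U j ω, U l ω), U m ω) ∂P = 0
  rw [← integral_map hV.aemeasurable hφm.aestronglyMeasurable, hmap]
  have := Measure.isProbabilityMeasure_map hjl.aemeasurable (μ := P)
  have hae : ∀ᵐ q ∂(P.map fun ω => (U j ω, U l ω)), q.1 ∈ Set.Ioo (0 : ℝ) 1 := by
    rw [ae_map_iff hjl.aemeasurable (measurable_fst measurableSet_Ioo)]
    exact hU.ae_mem_Ioo.mono fun ω hω => hω j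
  rw [integral_prod]
  · refine integral_eq_zero_of_ae ?_
    filter_upwards [hae] with q hq
    simp only [hφ, Pi.zero_apply]
    rw [integral_const_mul, integral_centredIndicator hq, mul_zero]
  · rw [← hmap, integrable_map_measure hφm.aestronglyMeasurable hV.aemeasurable]
    exact (hU.memLp_centredIndicator j l).integrable_mul (hU.memLp_centredIndicator j m)

/-- The empirical distribution function is close to the identity in mean square, at each of the
sample points. -/
lemma IsUniformSample.integral_sum_centredIndicator_sq_le (hU : IsUniformSample U P)
    (j : Fin N) : ∫ ω, (∑ l, centredIndicator (U j ω) (U l ω)) ^ 2 ∂P ≤ 2 * N := by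
  have hL := hU.memLp_centredIndicator j
  have hsq : ∀ l, ∫ ω, ‖centredIndicator (U j ω) (U l ω)‖ ^ 2 ∂P ≤ 1 := by
    intro l
    refine (integral_mono_of_nonneg (Filter.Eventually.of_forall fun ω => by positivity)
      (integrable_const (1 : ℝ)) ?_).trans (by simp)
    filter_upwards [hU.ae_mem_Ioo] with ω hω
    exact pow_le_one₀ (norm_nonneg _) (abs_centredIndicator_le (hω j) _)
  -- The term `l = j` equals `1 - U j`, which is not centred given `U j`. Splitting it off costs a
  -- factor 2, and `2·1 + 2(N - 1) = 2N`.
  have hrest : ∫ ω, ‖∑ l ∈ Finset.univ.erase j, centredIndicator (U j ω) (U l ω)‖ ^ 2 ∂P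
      ≤ (N : ℝ) - 1 := by
    rw [integral_norm_sq_sum_of_orthogonal fun l _ => hL l]
    · refine (Finset.sum_le_card_nsmul _ _ 1 fun l _ => hsq l).trans (le_of_eq ?_)
      have hN : 1 ≤ N := (Nat.zero_le _).trans_lt j.isLt
      rw [Finset.card_erase_of_mem (Finset.mem_univ _), Finset.card_univ, Fintype.card_fin,
        nsmul_eq_mul, mul_one, Nat.cast_sub hN, Nat.cast_one]
    · intro l _ m hm hlm
      refine (integral_congr_ae (Filter.Eventually.of_forall fun ω => ?_)).trans
        (hU.integral_centredIndicator_mul (Finset.ne_of_mem_erase hm).symm hlm)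
      exact (real_inner_comm _ _).trans rfl
  have hLs : MemLp (fun ω => ∑ l ∈ Finset.univ.erase j, centredIndicator (U j ω) (U l ω)) 2 P :=
    memLp_finsetSum _ fun l _ => hL l
  have hi1 := (hL j).integrable_norm_pow'
  have hi2 := hLs.integrable_norm_pow'
  calc ∫ ω, (∑ l, centredIndicator (U j ω) (U l ω)) ^ 2 ∂P
      ≤ ∫ ω, (2 * ‖centredIndicator (U j ω) (U j ω)‖ ^ 2 +
        2 * ‖∑ l ∈ Finset.univ.erase j, centredIndicator (U j ω) (U l ω)‖ ^ 2) ∂P := by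
        refine integral_mono_of_nonneg (Filter.Eventually.of_forall fun ω => by positivity)
          ((hi1.const_mul 2).add (hi2.const_mul 2)) (Filter.Eventually.of_forall fun ω => ?_)
        simp only [Real.norm_eq_abs, sq_abs]
        rw [← Finset.add_sum_erase _ _ (Finset.mem_univ j)]
        nlinarith [sq_nonneg (centredIndicator (U j ω) (U j ω) -
          ∑ l ∈ Finset.univ.erase j, centredIndicator (U j ω) (U l ω))]
    _ ≤ 2 * N := by
        rw [integral_add (hi1.const_mul 2) (hi2.const_mul 2), integral_const_mul,
          integral_const_mul]
        linarith [hsq j]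

end Sample

/-! ### Mean square of the noise -/

/-- The mean square of a linear combination of noise values at distinct locations. -/
lemma IsNoise.integral_norm_sq_sum {Ω : Type*} [MeasurableSpace Ω] {ε : ℝ → Ω → ℂ} {σ : ℝ}
    {Q : Measure Ω} [IsProbabilityMeasure Q] (hε : IsNoise ε σ Q) {N : ℕ} {t : Fin N → ℝ}
    (ht : ∀ i, t i ∈ Set.Ioo (0 : ℝ) 1) (hinj : Function.Injective t) {w : Fin N → ℂ}
    (hw : ∀ i, ‖w i‖ = 1) :
    ∫ ω, ‖∑ i, ε (t i) ω * w i‖ ^ 2 ∂Q = N * σ ^ 2 := by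
  have hL : ∀ i, MemLp (fun ω => ε (t i) ω * w i) 2 Q := fun i =>
    (hε.memLp _ (ht i)).mul_const (w i)
  have h0 : ∀ i, ∫ ω, ε (t i) ω * w i ∂Q = 0 := by
    intro i
    rw [integral_mul_const, hε.mean _ (ht i), zero_mul]
  rw [integral_norm_sq_sum_of_orthogonal fun i _ => hL i]
  · simp [hw, hε.variance _ (ht _)]
  · intro i _ j _ hij
    exact (((hε.indep N t ht hinj).indepFun hij).comp (measurable_mul_const (w i))
      (measurable_mul_const (w j))).integral_inner_eq_zero
      ((hL i).integrable one_le_two) ((hL j).integrable one_le_two) (h0 i)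

/-! ### Deterministic error of the estimated coefficients -/

/-- When the points are distinct, exactly `i + 1` of them are at most entry `i` of the sorted list.
-/
lemma sum_centredIndicator_sorted {N : ℕ} {u : Fin N → ℝ} (hu : Function.Injective u)
    (i : Fin N) :
    ∑ l, centredIndicator (sorted u i) (u l) = ((i : ℕ) + 1 : ℝ) - N * sorted u i := by
  have hmono : StrictMono (sorted u) :=
    (Tuple.monotone_sort u).strictMono_of_injective (hu.comp (Tuple.sort u).injective)
  rw [← Equiv.sum_comp (Tuple.sort u)]
  have h : ∀ l, centredIndicator (sorted u i) (u (Tuple.sort u l)) =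
      (if l ∈ Finset.Iic i then 1 else 0) - sorted u i := by
    intro l
    have : u (Tuple.sort u l) ≤ sorted u i ↔ l ∈ Finset.Iic i := by
      rw [Finset.mem_Iic]
      exact hmono.le_iff_le
    simp only [centredIndicator, this]
  simp_rw [h]
  rw [Finset.sum_sub_distrib, Finset.sum_ite_mem]
  simp

/-- A sum over all ranks is a sum over all sample points, so sorting disappears and only the i.i.d.
variables remain. -/
lemma sum_sq_sorted_sub {N : ℕ} (hN : 0 < N) {u : Fin N → ℝ} (hu : Function.Injective u) :
    ∑ i : Fin N, (((i : ℕ) + 1 : ℝ) / N - sorted u i) ^ 2 =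
      (∑ j, (∑ l, centredIndicator (u j) (u l)) ^ 2) / (N : ℝ) ^ 2 := by
  rw [← Equiv.sum_comp (Tuple.sort u) fun j => (∑ l, centredIndicator (u j) (u l)) ^ 2,
    Finset.sum_div]
  refine Finset.sum_congr rfl fun i _ => ?_
  have := sum_centredIndicator_sorted hu i
  simp only [sorted, Function.comp_apply] at this ⊢
  rw [this]
  have : (N : ℝ) ≠ 0 := by positivity
  field_simp

/-- The error made by placing the sorted samples at an equidistant grid. -/
lemma norm_sq_sum_grid_le {N : ℕ} (hN : 0 < N) {u : Fin N → ℝ} (hu : Function.Injective u)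
    {g : ℝ → ℂ} (hg : IsUnitSignal g) (k : ℤ) :
    ‖∑ i : Fin N, g (sorted u i) *
      (expMode k (((i : ℕ) + 1 : ℝ) / N) - expMode k (sorted u i))‖ ^ 2 ≤
      4 * Real.pi ^ 2 * (k : ℝ) ^ 2 / N * ∑ j, (∑ l, centredIndicator (u j) (u l)) ^ 2 := by
  have h1 : ‖∑ i : Fin N, g (sorted u i) *
      (expMode k (((i : ℕ) + 1 : ℝ) / N) - expMode k (sorted u i))‖ ≤
      2 * Real.pi * |(k : ℝ)| * ∑ i : Fin N, |((i : ℕ) + 1 : ℝ) / N - sorted u i| := by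
    rw [Finset.mul_sum]
    refine (norm_sum_le _ _).trans (Finset.sum_le_sum fun i _ => ?_)
    rw [norm_mul]
    refine (mul_le_of_le_one_left (norm_nonneg _) (hg.norm_lt_one _).le).trans ?_
    exact norm_expMode_sub_le _ _ _
  have h2 := sq_sum_le_card_mul_sum_sq (s := Finset.univ)
    (f := fun i : Fin N => |((i : ℕ) + 1 : ℝ) / N - sorted u i|)
  simp only [sq_abs, Finset.card_univ, Fintype.card_fin] at h2
  rw [sum_sq_sorted_sub hN hu] at h2
  have hN' : (0 : ℝ) < N := by exact_mod_cast hN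
  calc _ ≤ (2 * Real.pi * |(k : ℝ)| * ∑ i : Fin N, |((i : ℕ) + 1 : ℝ) / N - sorted u i|) ^ 2 :=
        pow_le_pow_left₀ (norm_nonneg _) h1 2
    _ = 4 * Real.pi ^ 2 * (k : ℝ) ^ 2 *
        (∑ i : Fin N, |((i : ℕ) + 1 : ℝ) / N - sorted u i|) ^ 2 := by
      rw [mul_pow, mul_pow, sq_abs]
      ring
    _ ≤ 4 * Real.pi ^ 2 * (k : ℝ) ^ 2 *
        (N * ((∑ j, (∑ l, centredIndicator (u j) (u l)) ^ 2) / (N : ℝ) ^ 2)) := by gcongr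
    _ = _ := by field_simp

/-- The error made by a good rearrangement of the samples. -/
lemma norm_sq_sum_perm_le {N δ Nδ : ℕ} {h : Equiv.Perm (Fin N)} (hh : IsGood δ Nδ h)
    (t : Fin N → ℝ) {g : ℝ → ℂ} (hg : IsUnitSignal g) (k : ℤ) :
    ‖∑ i : Fin N, g (t (h i)) * (expMode k (((i : ℕ) + 1 : ℝ) / N) -
      expMode k (((h i : ℕ) + 1 : ℝ) / N))‖ ^ 2 ≤
      8 * N * Nδ + 8 * Real.pi ^ 2 * (k : ℝ) ^ 2 * (δ : ℝ) ^ 2 := by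
  rcases Nat.eq_zero_or_pos N with rfl | hN
  · simp
    positivity
  have hN' : (0 : ℝ) < N := by exact_mod_cast hN
  set B := Finset.univ.filter fun i : Fin N => (δ : ℤ) < |((i : ℕ) : ℤ) - ((h i : ℕ) : ℤ)|
    with hB
  have hterm : ∀ i : Fin N, ‖g (t (h i)) * (expMode k (((i : ℕ) + 1 : ℝ) / N) -
      expMode k (((h i : ℕ) + 1 : ℝ) / N))‖ ≤
      (if i ∈ B then 2 else 0) + 2 * Real.pi * |(k : ℝ)| * (δ / N) := by
    intro i
    rw [norm_mul]
    refine (mul_le_of_le_one_left (norm_nonneg _) (hg.norm_lt_one _).le).trans ?_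
    split_ifs with hi
    · have : 0 ≤ 2 * Real.pi * |(k : ℝ)| * (δ / N) := by positivity
      refine (norm_sub_le _ _).trans ?_
      rw [norm_expMode, norm_expMode]
      linarith
    · rw [zero_add]
      refine (norm_expMode_sub_le _ _ _).trans ?_
      have hle : |((i : ℕ) : ℤ) - ((h i : ℕ) : ℤ)| ≤ δ := by
        simpa [hB] using hi
      have hle' : |((i : ℕ) : ℝ) - ((h i : ℕ) : ℝ)| ≤ δ := by exact_mod_cast hle
      have : ((i : ℕ) + 1 : ℝ) / N - ((h i : ℕ) + 1 : ℝ) / N =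
          (((i : ℕ) : ℝ) - ((h i : ℕ) : ℝ)) / N := by ring
      rw [this, abs_div, abs_of_pos hN']
      gcongr
  have hsum : ‖∑ i : Fin N, g (t (h i)) * (expMode k (((i : ℕ) + 1 : ℝ) / N) -
      expMode k (((h i : ℕ) + 1 : ℝ) / N))‖ ≤
      2 * (B.card : ℝ) + 2 * Real.pi * |(k : ℝ)| * δ := by
    refine (norm_sum_le _ _).trans ((Finset.sum_le_sum fun i _ => hterm i).trans (le_of_eq ?_))
    rw [Finset.sum_add_distrib, Finset.sum_ite_mem]
    simp only [Finset.univ_inter, Finset.sum_const, Finset.card_univ, Fintype.card_fin,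
      nsmul_eq_mul]
    field_simp
  have hc1 : (B.card : ℝ) ≤ Nδ := by exact_mod_cast hh
  have hc2 : (B.card : ℝ) ≤ N := by exact_mod_cast (Finset.card_le_univ B).trans (by simp)
  -- Using both bounds on the cardinality keeps the final estimate linear in `Nδ` after division by
  -- `N²`.
  have hc : (B.card : ℝ) ^ 2 ≤ N * Nδ := by
    rw [sq]
    exact mul_le_mul hc2 hc1 (by positivity) (by positivity)
  calc _ ≤ (2 * (B.card : ℝ) + 2 * Real.pi * |(k : ℝ)| * δ) ^ 2 :=
        pow_le_pow_left₀ (norm_nonneg _) hsum 2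
    _ ≤ 8 * (B.card : ℝ) ^ 2 + 8 * Real.pi ^ 2 * |(k : ℝ)| ^ 2 * (δ : ℝ) ^ 2 := by
      nlinarith [sq_nonneg (2 * (B.card : ℝ) - 2 * Real.pi * |(k : ℝ)| * δ)]
    _ ≤ _ := by
      rw [sq_abs]
      nlinarith

/-- The squared error of the estimated Fourier coefficient without noise. -/
lemma norm_sq_sigCoeff_sub_estCoeff_le {N δ Nδ : ℕ} (hN : 0 < N) {h : Equiv.Perm (Fin N)}
    (hh : IsGood δ Nδ h) {u : Fin N → ℝ} (hu : Function.Injective u) {g : ℝ → ℂ}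
    (hg : IsUnitSignal g) (k : ℤ) :
    ‖sigCoeff g k - estCoeff (fun i => g (sorted u (h i))) k‖ ^ 2 ≤
      3 / (N : ℝ) ^ 2 * ‖∑ i, (expMode k (u i) * g (u i) - sigCoeff g k)‖ ^ 2
      + 12 * Real.pi ^ 2 * (k : ℝ) ^ 2 / (N : ℝ) ^ 3 *
          ∑ j, (∑ l, centredIndicator (u j) (u l)) ^ 2
      + 24 * Nδ / N + 24 * Real.pi ^ 2 * (k : ℝ) ^ 2 * (δ : ℝ) ^ 2 / (N : ℝ) ^ 2 := by
  have hN' : (0 : ℝ) < N := by exact_mod_cast hN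
  have hNC : (N : ℂ) ≠ 0 := by exact_mod_cast hN.ne'
  have hB := norm_sq_sum_grid_le hN hu hg k
  have hC := norm_sq_sum_perm_le hh (sorted u) hg k
  set A := ∑ i, (expMode k (u i) * g (u i) - sigCoeff g k) with hA
  set B := ∑ i : Fin N, g (sorted u i) *
    (expMode k (((i : ℕ) + 1 : ℝ) / N) - expMode k (sorted u i)) with hBdef
  set C := ∑ i : Fin N, g (sorted u (h i)) * (expMode k (((i : ℕ) + 1 : ℝ) / N) -
    expMode k (((h i : ℕ) + 1 : ℝ) / N)) with hCdef
  -- `A`, `B`, `C` telescope: from the true coefficient to the empirical one (insensitive to order),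
  -- to sorted values on the grid, to permuted values on the grid.
  have hA' : A = ∑ i, g (sorted u i) * expMode k (sorted u i) - N * sigCoeff g k := by
    rw [hA, Finset.sum_sub_distrib, ← Equiv.sum_comp (Tuple.sort u)]
    simp [sorted, mul_comm]
  have hC' : C = ∑ i : Fin N, g (sorted u (h i)) * expMode k (((i : ℕ) + 1 : ℝ) / N) -
      ∑ i : Fin N, g (sorted u i) * expMode k (((i : ℕ) + 1 : ℝ) / N) := by
    rw [hCdef, ← Equiv.sum_comp h fun i : Fin N =>
      g (sorted u i) * expMode k (((i : ℕ) + 1 : ℝ) / N), ← Finset.sum_sub_distrib]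
    simp_rw [mul_sub]
  have hB' : B = ∑ i : Fin N, g (sorted u i) * expMode k (((i : ℕ) + 1 : ℝ) / N) -
      ∑ i, g (sorted u i) * expMode k (sorted u i) := by
    rw [hBdef, ← Finset.sum_sub_distrib]
    simp_rw [mul_sub]
  have hsplit : sigCoeff g k - estCoeff (fun i => g (sorted u (h i))) k =
      -(1 / (N : ℂ)) * (A + B + C) := by
    rw [estCoeff_eq_sum, hA', hB', hC']
    field_simp
    ring
  have habc : ‖A + B + C‖ ^ 2 ≤ 3 * (‖A‖ ^ 2 + ‖B‖ ^ 2 + ‖C‖ ^ 2) := by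
    refine (pow_le_pow_left₀ (norm_nonneg _) (norm_add₃_le (a := A) (b := B) (c := C)) 2).trans ?_
    nlinarith [sq_nonneg (‖A‖ - ‖B‖), sq_nonneg (‖A‖ - ‖C‖), sq_nonneg (‖B‖ - ‖C‖)]
  rw [hsplit, norm_mul, mul_pow]
  have hn : ‖-(1 / (N : ℂ))‖ ^ 2 = 1 / (N : ℝ) ^ 2 := by
    simp
  rw [hn]
  calc 1 / (N : ℝ) ^ 2 * ‖A + B + C‖ ^ 2
      ≤ 1 / (N : ℝ) ^ 2 * (3 * (‖A‖ ^ 2 +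
        4 * Real.pi ^ 2 * (k : ℝ) ^ 2 / N * ∑ j, (∑ l, centredIndicator (u j) (u l)) ^ 2 +
        (8 * N * Nδ + 8 * Real.pi ^ 2 * (k : ℝ) ^ 2 * (δ : ℝ) ^ 2))) := by
        gcongr
        refine habc.trans ?_
        gcongr
    _ = _ := by
        field_simp
        ring

/-! ### Expectations over noise and locations -/

/-- The expectation over the noise, at fixed sampling locations. -/
lemma lintegral_sqDist_samples_le {Ω' : Type*} [MeasurableSpace Ω'] {Q : Measure Ω'}
    [IsProbabilityMeasure Q] {ε : ℝ → Ω' → ℂ} {σ d γ : ℝ} (hε : IsNoise ε σ Q)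
    {N k₁ k₀ : ℕ} (hN : 0 < N) {g : ℝ → ℂ} (hγ : 0 < γ) (hg : IsUnitSignal g)
    (hb : IsQuasiBandlimited d k₁ γ g) (hk : k₁ ≤ k₀) (h : Equiv.Perm (Fin N))
    {u : Fin N → ℝ} (hu : Function.Injective u) (hu' : ∀ i, u i ∈ Set.Ioo (0 : ℝ) 1) :
    ∫⁻ ω', sqDist g (reconstruction (samples g h ε u ω') k₀) ∂Q ≤ ENNReal.ofReal
      (∑ k ∈ Finset.Icc (-(k₀ : ℤ)) k₀,
        (2 * ‖sigCoeff g k - estCoeff (fun i => g (sorted u (h i))) k‖ ^ 2 + 2 * (σ ^ 2 / N))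
        + 2 * d ^ 2 * Real.exp (-γ * k₀) * (1 + 1 / γ)) := by
  have hN' : (0 : ℝ) < N := by exact_mod_cast hN
  set b : ℤ → ℂ := fun k => sigCoeff g k - estCoeff (fun i => g (sorted u (h i))) k with hbdef
  set t : Fin N → ℝ := fun i => sorted u (h i) with ht
  set Z : ℤ → Ω' → ℂ := fun k ω' =>
    ∑ i : Fin N, ε (t i) ω' * expMode k (((i : ℕ) + 1 : ℝ) / N) with hZ
  set T := 2 * d ^ 2 * Real.exp (-γ * k₀) * (1 + 1 / γ) with hT
  have hT0 : 0 ≤ T := by positivity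
  have ht1 : ∀ i, t i ∈ Set.Ioo (0 : ℝ) 1 := fun i => hu' _
  have htinj : Function.Injective t :=
    hu.comp ((Tuple.sort u).injective.comp h.injective)
  have hZL : ∀ k, MemLp (Z k) 2 Q := fun k =>
    memLp_finsetSum _ fun i _ => (hε.memLp _ (ht1 i)).mul_const _
  have hZi : ∀ k, Integrable (fun ω' => ‖Z k ω'‖ ^ 2) Q := fun k => (hZL k).integrable_norm_pow'
  have hpt : ∀ ω', sqDist g (reconstruction (samples g h ε u ω') k₀) ≤ ENNReal.ofReal
      (∑ k ∈ Finset.Icc (-(k₀ : ℤ)) k₀,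
        (2 * ‖b k‖ ^ 2 + 2 / (N : ℝ) ^ 2 * ‖Z k ω'‖ ^ 2) + T) := by
    intro ω'
    refine (sqDist_reconstruction_le hγ hg hb hk _).trans (ENNReal.ofReal_le_ofReal ?_)
    gcongr with k
    have hs : sigCoeff g k - estCoeff (samples g h ε u ω') k =
        b k - (1 / (N : ℂ)) * Z k ω' := by
      simp only [hbdef, hZ, estCoeff_eq_sum, samples, add_mul, Finset.sum_add_distrib, ht]
      ring
    have hn : ‖(1 / (N : ℂ)) * Z k ω'‖ ^ 2 = 1 / (N : ℝ) ^ 2 * ‖Z k ω'‖ ^ 2 := by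
      rw [norm_mul, mul_pow]
      simp
    rw [hs]
    calc _ ≤ (‖b k‖ + ‖(1 / (N : ℂ)) * Z k ω'‖) ^ 2 :=
          pow_le_pow_left₀ (norm_nonneg _) (norm_sub_le _ _) 2
      _ ≤ 2 * ‖b k‖ ^ 2 + 2 * ‖(1 / (N : ℂ)) * Z k ω'‖ ^ 2 := by
          nlinarith [sq_nonneg (‖b k‖ - ‖(1 / (N : ℂ)) * Z k ω'‖)]
      _ = _ := by
          rw [hn]
          ring
  have hi : ∀ k, Integrable (fun ω' => 2 * ‖b k‖ ^ 2 + 2 / (N : ℝ) ^ 2 * ‖Z k ω'‖ ^ 2) Q :=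
    fun k => (integrable_const _).add ((hZi k).const_mul _)
  have hI := integrable_finsetSum (Finset.Icc (-(k₀ : ℤ)) k₀) fun k _ => hi k
  refine (lintegral_mono hpt).trans (le_of_eq ?_)
  have hIT := hI.add (integrable_const T)
  simp only [Pi.add_def] at hIT
  rw [← ofReal_integral_eq_lintegral_ofReal hIT (Filter.Eventually.of_forall fun ω' => by simp only [Pi.zero_apply]; positivity)]
  congr 1
  rw [integral_add hI (integrable_const T), integral_finsetSum _ fun k _ => hi k]
  congr 1
  · refine Finset.sum_congr rfl fun k _ => ?_
    have hZE : ∫ ω', ‖Z k ω'‖ ^ 2 ∂Q = N * σ ^ 2 :=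
      hε.integral_norm_sq_sum ht1 htinj fun i => norm_expMode _ _
    rw [integral_add (integrable_const _) ((hZi k).const_mul _),
      integral_const_mul (2 / (N : ℝ) ^ 2), hZE]
    simp only [integral_const, probReal_univ, one_smul, hbdef]
    field_simp
  · simp

/-- The expected error of the reconstruction, with explicit constants. -/
lemma expectedError_le {Ω Ω' : Type*} [MeasurableSpace Ω] [MeasurableSpace Ω']
    {P : Measure Ω} [IsProbabilityMeasure P] {Q : Measure Ω'} [IsProbabilityMeasure Q]
    {g : ℝ → ℂ} {k₁ k₀ N δ Nδ : ℕ} {d γ σ : ℝ} {h : Equiv.Perm (Fin N)}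
    {U : Fin N → Ω → ℝ} {ε : ℝ → Ω' → ℂ} (hN : 0 < N) (hγ : 0 < γ) (hg : IsUnitSignal g)
    (hb : IsQuasiBandlimited d k₁ γ g) (hU : IsUniformSample U P) (hh : IsGood δ Nδ h)
    (hε : IsNoise ε σ Q) (hk : k₁ ≤ k₀) :
    expectedError g h U P ε Q k₀ ≤ ENNReal.ofReal
      ((2 * k₀ + 1) * (24 / N + 480 * (k₀ : ℝ) ^ 2 / N + 48 * Nδ / N
        + 480 * (k₀ : ℝ) ^ 2 * (δ : ℝ) ^ 2 / (N : ℝ) ^ 2 + 2 * (σ ^ 2 / N))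
        + 2 * d ^ 2 * Real.exp (-γ * k₀) * (1 + 1 / γ)) := by
  have hN' : (0 : ℝ) < N := by exact_mod_cast hN
  set T := 2 * d ^ 2 * Real.exp (-γ * k₀) * (1 + 1 / γ) with hT
  have hT0 : 0 ≤ T := by positivity
  set A : ℤ → Ω → ℝ := fun k ω =>
    ‖∑ i, (expMode k (U i ω) * g (U i ω) - sigCoeff g k)‖ ^ 2 with hA
  set W : Ω → ℝ := fun ω => ∑ j, (∑ l, centredIndicator (U j ω) (U l ω)) ^ 2 with hW
  have hA0 : ∀ k ω, 0 ≤ A k ω := fun k ω => by positivity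
  have hW0 : ∀ ω, 0 ≤ W ω := fun ω => Finset.sum_nonneg fun j _ => sq_nonneg _
  have hAi : ∀ k, Integrable (A k) P := fun k =>
    (memLp_finsetSum Finset.univ fun i _ => hU.memLp_expMode_mul_sub hg k i).integrable_norm_pow'
  have hWi' : ∀ j, Integrable (fun ω => (∑ l, centredIndicator (U j ω) (U l ω)) ^ 2) P :=
    fun j => (memLp_finsetSum Finset.univ fun l _ => hU.memLp_centredIndicator j l).integrable_sq
  have hWi : Integrable W P := integrable_finsetSum _ fun j _ => hWi' j
  have hAE : ∀ k, ∫ ω, A k ω ∂P ≤ 4 * N := fun k => hU.integral_norm_sq_sum_le hg k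
  have hWE : ∫ ω, W ω ∂P ≤ 2 * (N : ℝ) ^ 2 := by
    rw [hW, integral_finsetSum _ fun j _ => hWi' j]
    refine (Finset.sum_le_card_nsmul _ _ (2 * N : ℝ) fun j _ =>
      hU.integral_sum_centredIndicator_sq_le j).trans (le_of_eq ?_)
    simp
    ring
  set c : ℝ := 48 * Nδ / N + 480 * (k₀ : ℝ) ^ 2 * (δ : ℝ) ^ 2 / (N : ℝ) ^ 2 + 2 * (σ ^ 2 / N)
    with hc
  have hc0 : 0 ≤ c := by positivity
  -- Source of the constants: `2·12π² ≤ 240`, doubled to 480 by `∫ W ≤ 2N²`; `2·24π² ≤ 480`; and `24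
  -- = 2·3·4` from `∫ A k ≤ 4N`.
  have hpi : Real.pi ^ 2 ≤ 10 := by
    nlinarith [Real.pi_lt_d2, Real.pi_pos]
  have hpt : ∀ᵐ ω ∂P,
      ∫⁻ ω', sqDist g (reconstruction (samples g h ε (fun i => U i ω) ω') k₀) ∂Q ≤
      ENNReal.ofReal (∑ k ∈ Finset.Icc (-(k₀ : ℤ)) k₀, (6 / (N : ℝ) ^ 2 * A k ω
        + 240 * (k₀ : ℝ) ^ 2 / (N : ℝ) ^ 3 * W ω + c) + T) := by
    filter_upwards [hU.ae_mem_Ioo, hU.ae_injective] with ω hω hinj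
    refine (lintegral_sqDist_samples_le hε hN hγ hg hb hk h hinj hω).trans
      (ENNReal.ofReal_le_ofReal ?_)
    refine add_le_add (Finset.sum_le_sum fun k hkmem => ?_) le_rfl
    have hkk : (k : ℝ) ^ 2 ≤ (k₀ : ℝ) ^ 2 := by
      rw [Finset.mem_Icc] at hkmem
      refine sq_le_sq' ?_ ?_
      · exact_mod_cast hkmem.1
      · exact_mod_cast hkmem.2
    have hpk : Real.pi ^ 2 * (k : ℝ) ^ 2 ≤ 10 * (k₀ : ℝ) ^ 2 := by gcongr
    have h1 := norm_sq_sigCoeff_sub_estCoeff_le hN hh hinj hg k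
    have h2 : 12 * Real.pi ^ 2 * (k : ℝ) ^ 2 / (N : ℝ) ^ 3 * W ω ≤
        120 * (k₀ : ℝ) ^ 2 / (N : ℝ) ^ 3 * W ω := by
      have := hW0 ω
      gcongr ?_ / _ * _
      linarith
    have h3 : 24 * Real.pi ^ 2 * (k : ℝ) ^ 2 * (δ : ℝ) ^ 2 / (N : ℝ) ^ 2 ≤
        240 * (k₀ : ℝ) ^ 2 * (δ : ℝ) ^ 2 / (N : ℝ) ^ 2 := by
      gcongr ?_ * _ / _
      linarith
    have h4 : 2 * ‖sigCoeff g k - estCoeff (fun i => g (sorted (fun i => U i ω) (h i))) k‖ ^ 2 ≤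
        2 * (3 / (N : ℝ) ^ 2 * A k ω + 120 * (k₀ : ℝ) ^ 2 / (N : ℝ) ^ 3 * W ω + 24 * Nδ / N
          + 240 * (k₀ : ℝ) ^ 2 * (δ : ℝ) ^ 2 / (N : ℝ) ^ 2) := by
      refine mul_le_mul_of_nonneg_left (h1.trans ?_) zero_le_two
      gcongr
    refine (add_le_add h4 le_rfl).trans (le_of_eq ?_)
    rw [hc]
    ring
  have hi : ∀ k, Integrable (fun ω => 6 / (N : ℝ) ^ 2 * A k ω
      + 240 * (k₀ : ℝ) ^ 2 / (N : ℝ) ^ 3 * W ω + c) P := fun k =>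
    (((hAi k).const_mul _).add (hWi.const_mul _)).add (integrable_const c)
  have hI := integrable_finsetSum (Finset.Icc (-(k₀ : ℤ)) k₀) fun k _ => hi k
  have hnn : ∀ ω, 0 ≤ ∑ k ∈ Finset.Icc (-(k₀ : ℤ)) k₀, (6 / (N : ℝ) ^ 2 * A k ω
        + 240 * (k₀ : ℝ) ^ 2 / (N : ℝ) ^ 3 * W ω + c) + T := fun ω => by
    have := hW0 ω
    refine add_nonneg (Finset.sum_nonneg fun k _ => ?_) hT0
    have := hA0 k ω
    positivity
  unfold expectedError
  -- Monotonicity requires no measurability of the inner expectation in `ω`; only the dominating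
  -- function has to be integrable.
  refine (lintegral_mono_ae hpt).trans ?_
  have hIT := hI.add (integrable_const T)
  simp only [Pi.add_def] at hIT
  rw [← ofReal_integral_eq_lintegral_ofReal hIT (Filter.Eventually.of_forall hnn)]
  apply ENNReal.ofReal_le_ofReal
  rw [integral_add hI (integrable_const T), integral_finsetSum _ fun k _ => hi k]
  have hterm : ∀ k ∈ Finset.Icc (-(k₀ : ℤ)) k₀, ∫ ω, (6 / (N : ℝ) ^ 2 * A k ω
      + 240 * (k₀ : ℝ) ^ 2 / (N : ℝ) ^ 3 * W ω + c) ∂P ≤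
      24 / N + 480 * (k₀ : ℝ) ^ 2 / N + c := by
    intro k _
    have hAW := ((hAi k).const_mul (6 / (N : ℝ) ^ 2)).add
      (hWi.const_mul (240 * (k₀ : ℝ) ^ 2 / (N : ℝ) ^ 3))
    simp only [Pi.add_def] at hAW
    rw [integral_add hAW (integrable_const c), integral_add ((hAi k).const_mul _) (hWi.const_mul _), integral_const_mul,
      integral_const_mul]
    simp only [integral_const, probReal_univ, one_smul]
    have h1 : 6 / (N : ℝ) ^ 2 * ∫ ω, A k ω ∂P ≤ 6 / (N : ℝ) ^ 2 * (4 * N) := by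
      gcongr
      exact hAE k
    have h2 : 240 * (k₀ : ℝ) ^ 2 / (N : ℝ) ^ 3 * ∫ ω, W ω ∂P ≤
        240 * (k₀ : ℝ) ^ 2 / (N : ℝ) ^ 3 * (2 * (N : ℝ) ^ 2) := by
      gcongr
    have e1 : 6 / (N : ℝ) ^ 2 * (4 * N) = 24 / N := by
      field_simp
      norm_num
    have e2 : 240 * (k₀ : ℝ) ^ 2 / (N : ℝ) ^ 3 * (2 * (N : ℝ) ^ 2) = 480 * (k₀ : ℝ) ^ 2 / N := by
      field_simp
      ring
    rw [e1] at h1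
    rw [e2] at h2
    gcongr
  have hcard : ((Finset.Icc (-(k₀ : ℤ)) k₀).card : ℝ) = 2 * k₀ + 1 := by
    rw [Int.card_Icc]
    have : ((k₀ : ℤ) + 1 - -(k₀ : ℤ)).toNat = 2 * k₀ + 1 := by omega
    rw [this]
    push_cast
    ring
  refine add_le_add ((Finset.sum_le_card_nsmul _ _ _ hterm).trans (le_of_eq ?_)) (by simp)
  rw [nsmul_eq_mul, hcard, hc]
  ring

/-! ### Choice of constants -/

theorem mainTheorem1 (d : ℝ) (hd : 0 ≤ d) :
    ∃ C₁ : ℝ, ∀ Γ : ℝ, 0 < Γ → ∃ C₂ : ℝ,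
      ∀ (Ω Ω' : Type*) [MeasurableSpace Ω] [MeasurableSpace Ω']
        (P : Measure Ω) [IsProbabilityMeasure P] (Q : Measure Ω') [IsProbabilityMeasure Q]
        (g : ℝ → ℂ) (k₁ : ℕ) (γ : ℝ) (N δ Nδ : ℕ) (h : Equiv.Perm (Fin N))
        (U : Fin N → Ω → ℝ) (ε : ℝ → Ω' → ℂ) (σ : ℝ),
        0 < γ → IsUnitSignal g → IsQuasiBandlimited d k₁ γ g →
        IsUniformSample U P → IsGood δ Nδ h → IsNoise ε σ Q →
        Real.exp (γ * k₁) < N →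
        (expectedError g h U P ε Q (bandwidth N γ) ≤
          ENNReal.ofReal (C₁ *
            (((Nδ : ℝ) * bandwidth N γ + (bandwidth N γ : ℝ) ^ 3) / N
              + (bandwidth N γ : ℝ) ^ 3 * (δ : ℝ) ^ 2 / (N : ℝ) ^ 2
              + (bandwidth N γ : ℝ) * σ ^ 2 / N))) ∧
        (1 ≤ k₁ ∨ γ ≤ Γ →
          expectedError g h U P ε Q (bandwidth N γ) ≤
            ENNReal.ofReal (C₂ *
              (((Nδ : ℝ) * γ ^ 2 * Real.log N + Real.log N ^ 3) / (γ ^ 3 * N)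
                + (δ : ℝ) ^ 2 * Real.log N ^ 3 / (γ ^ 3 * (N : ℝ) ^ 2)
                + σ ^ 2 * Real.log N / (γ * N)))) := by
  -- With `2k₀ + 1 ≤ 3k₀`, the coefficient of `k₀³/N` is `3·24 + 3·480 = 1512`, which dominates the
  -- other ones; `6d²` comes from `1 + 1/γ ≤ 3k₀`. The cube pays for replacing `k₀³`.
  refine ⟨1512 + 6 * d ^ 2, fun Γ hΓ => ⟨(1512 + 6 * d ^ 2) * (2 + 2 * Γ) ^ 3, ?_⟩⟩
  intro Ω Ω' _ _ P _ Q _ g k₁ γ N δ Nδ h U ε σ hγ hg hb hU hh hε hexp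
  have hN1 : (1 : ℝ) < N := lt_of_le_of_lt (Real.one_le_exp (by positivity)) hexp
  have hN2 : 2 ≤ N := by exact_mod_cast hN1
  have hN' : (0 : ℝ) < N := by linarith
  have hlogk : γ * k₁ < Real.log N := (Real.lt_log_iff_exp_lt hN').2 hexp
  have hlog2 : 1 / 2 ≤ Real.log N := by
    have h1 : Real.log 2 ≤ Real.log N := Real.log_le_log two_pos (by exact_mod_cast hN2)
    linarith [Real.log_two_gt_d9]
  set L := Real.log N with hL
  set k₀ := bandwidth N γ with hk₀
  have hle : L / γ ≤ k₀ := Nat.le_ceil _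
  have hlt : (k₀ : ℝ) < L / γ + 1 := Nat.ceil_lt_add_one (by positivity)
  have hk : k₁ ≤ k₀ := by
    have h1 : (k₁ : ℝ) < L / γ := by
      rw [lt_div_iff₀ hγ]
      linarith
    exact_mod_cast (h1.trans_le hle).le
  have hk1 : (1 : ℝ) ≤ k₀ := by
    have : (0 : ℝ) < k₀ := lt_of_lt_of_le (by positivity) hle
    exact_mod_cast this
  -- Here `log N ≥ 1/2` enters, through `1/γ ≤ 2 log N / γ`.
  have hγk : 1 / γ ≤ 2 * k₀ := by
    have : 1 / γ = 2 * (1 / 2 / γ) := by ring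
    rw [this]
    refine mul_le_mul_of_nonneg_left (le_trans ?_ hle) zero_le_two
    gcongr
  have hdecay : Real.exp (-γ * k₀) ≤ 1 / N := by
    rw [one_div, ← Real.exp_log hN', ← Real.exp_neg]
    apply Real.exp_le_exp.2
    rw [div_le_iff₀ hγ] at hle
    linarith
  have hfirst : expectedError g h U P ε Q k₀ ≤ ENNReal.ofReal ((1512 + 6 * d ^ 2) *
      (((Nδ : ℝ) * k₀ + (k₀ : ℝ) ^ 3) / N + (k₀ : ℝ) ^ 3 * (δ : ℝ) ^ 2 / (N : ℝ) ^ 2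
        + (k₀ : ℝ) * σ ^ 2 / N)) := by
    refine (expectedError_le (by omega) hγ hg hb hU hh hε hk).trans
      (ENNReal.ofReal_le_ofReal ?_)
    have hk3 : (k₀ : ℝ) ≤ (k₀ : ℝ) ^ 3 := le_self_pow₀ hk1 (by norm_num)
    have h3k : (2 * k₀ + 1 : ℝ) ≤ 3 * k₀ := by linarith
    have hT : 2 * d ^ 2 * Real.exp (-γ * k₀) * (1 + 1 / γ) ≤ 6 * d ^ 2 * ((k₀ : ℝ) ^ 3 / N) := by
      calc 2 * d ^ 2 * Real.exp (-γ * k₀) * (1 + 1 / γ)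
          ≤ 2 * d ^ 2 * (1 / N) * (3 * (k₀ : ℝ) ^ 3) := by
            gcongr
            linarith
        _ = _ := by ring
    set x := (k₀ : ℝ) ^ 3 / N with hx
    set y := (Nδ : ℝ) * k₀ / N with hy
    set z := (k₀ : ℝ) ^ 3 * (δ : ℝ) ^ 2 / (N : ℝ) ^ 2 with hz
    set w := (k₀ : ℝ) * σ ^ 2 / N with hw
    have hx0 : 0 ≤ x := by positivity
    have hy0 : 0 ≤ y := by positivity
    have hz0 : 0 ≤ z := by positivity
    have hw0 : 0 ≤ w := by positivity
    have hxk : (k₀ : ℝ) / N ≤ x := by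
      rw [hx]
      gcongr
    have hS : (2 * k₀ + 1 : ℝ) * (24 / N + 480 * (k₀ : ℝ) ^ 2 / N + 48 * Nδ / N
        + 480 * (k₀ : ℝ) ^ 2 * (δ : ℝ) ^ 2 / (N : ℝ) ^ 2 + 2 * (σ ^ 2 / N)) ≤
        1512 * x + 144 * y + 1440 * z + 6 * w := by
      refine (mul_le_mul_of_nonneg_right h3k (by positivity)).trans ?_
      have : 3 * (k₀ : ℝ) * (24 / N + 480 * (k₀ : ℝ) ^ 2 / N + 48 * Nδ / N
        + 480 * (k₀ : ℝ) ^ 2 * (δ : ℝ) ^ 2 / (N : ℝ) ^ 2 + 2 * (σ ^ 2 / N)) =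
          72 * (k₀ / N) + 1440 * x + 144 * y + 1440 * z + 6 * w := by
        rw [hx, hy, hz, hw]
        ring
      rw [this]
      linarith
    have hsplit : ((Nδ : ℝ) * k₀ + (k₀ : ℝ) ^ 3) / N = y + x := by rw [hx, hy, add_div]
    rw [hsplit]
    have : 0 ≤ d ^ 2 * (y + z + w) := by positivity
    nlinarith
  refine ⟨hfirst, fun hcase => hfirst.trans (ENNReal.ofReal_le_ofReal ?_)⟩
  -- The ceiling adds up to 1, which must be absorbed into `L / γ`. Either `k₁ ≥ 1` forces `L > γ`,
  -- or `γ ≤ Γ` and `L ≥ 1/2` give `1 ≤ 2Γ(L / γ)`.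
  have hratio : (k₀ : ℝ) ≤ (2 + 2 * Γ) * (L / γ) := by
    have h1 : 1 ≤ (1 + 2 * Γ) * (L / γ) := by
      rw [← mul_div_assoc, le_div_iff₀ hγ, one_mul]
      rcases hcase with hk₁ | hγΓ
      · have : (1 : ℝ) ≤ k₁ := by exact_mod_cast hk₁
        nlinarith
      · nlinarith
    linarith
  set c := 2 + 2 * Γ with hc
  have hc1 : 1 ≤ c := by linarith
  have hc3 : c ≤ c ^ 3 := le_self_pow₀ hc1 (by norm_num)
  have hL0 : 0 ≤ L / γ := by positivity
  have hr1 : (k₀ : ℝ) ≤ c ^ 3 * (L / γ) :=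
    hratio.trans (mul_le_mul_of_nonneg_right hc3 hL0)
  have hr3 : (k₀ : ℝ) ^ 3 ≤ c ^ 3 * (L / γ) ^ 3 := by
    rw [← mul_pow]
    gcongr
  rw [mul_assoc]
  refine mul_le_mul_of_nonneg_left ?_ (by positivity)
  calc ((Nδ : ℝ) * k₀ + (k₀ : ℝ) ^ 3) / N + (k₀ : ℝ) ^ 3 * (δ : ℝ) ^ 2 / (N : ℝ) ^ 2
        + (k₀ : ℝ) * σ ^ 2 / N
      ≤ ((Nδ : ℝ) * (c ^ 3 * (L / γ)) + c ^ 3 * (L / γ) ^ 3) / N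
        + c ^ 3 * (L / γ) ^ 3 * (δ : ℝ) ^ 2 / (N : ℝ) ^ 2
        + c ^ 3 * (L / γ) * σ ^ 2 / N := by gcongr
    _ = _ := by
      field_simp
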